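/- Let $\mathcal{A}$ and $\mathcal{B}$ be von Neumann algebras acting on complex Hilbert spaces $H$ and $K$, and let $\mathcal{A}\otimes\mathcal{B}$ be their von Neumann algebra tensor product. Let $T:\mathcal{A}\otimes\mathcal{B}\to\mathcal{A}$ be a CP-map, i.e. a completely positive linear map with $T(\mathbf 1)=\mathbf 1$ that is weakly (that is, $\sigma$-weakly) continuous. Put $(X,Y):=T(X^\dagger Y)-T(X)^\dagger T(Y)$. Let $B\in\mathcal{B}$ be Hermitian, and define $A:=T(\mathbf 1\otimes B)$, $\Sigma:=\|(\mathbf 1\otimes B,\mathbf 1\otimes B)\|^{1/2}$ and $R:\mathcal{A}\to\mathcal{A}$, $R(X):=T(X\otimes\mathbf 1)$. Let $R^*$ be the dual of $R$, determined by $\mathbf{tr}(R^*(\rho)X)=\mathbf{tr}(\rho R(X))$ for all $X\in\mathcal{A}$, and let $$D(\tau,\rho):=\sup\{\,|\mathbf{tr}(\tau P)-\mathbf{tr}(\rho P)| \;:\; P\in\mathcal{A},\ P^2=P^\dagger=P\,\}$$ be the trace distance. Suppose that $\psi_x,\psi_y\in H$ are unit eigenvectors of $A$ with eigenvalues $x\neq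 y$ respectively. Then for all $\alpha,\beta\in\mathbb{C}$ with $|\alpha|^2+|\beta|^2=1$, $$D\Big(R^*\big(|\alpha\psi_x+\beta\psi_y\rangle\langle\alpha\psi_x+\beta\psi_y|\big),\,R^*\big(|\alpha|^2|\psi_x\rangle\langle\psi_x|+|\beta|^2|\psi_y\rangle\langle\psi_y|\big)\Big)\;\le\;\frac{\Sigma/|x-y|}{\sqrt{1+4\,(\Sigma/|x-y|)^2}}.$$ The bound is sharp: for every real $s\ge 0$ there exist $H$, $K$, $\mathcal{A}$, $\mathcal{B}$, $T$, $B$, $\psi_x$, $\psi_y$, $\alpha$, $\beta$ as above with $\Sigma/|x-y|=s$ for which equality holds. -/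

import Mathlib

open scoped TensorProduct CStarAlgebra ENNReal

universe u v

noncomputable section

namespace QTransfer

section Algebra

variable {H : Type u} [NormedAddCommGroup H] [InnerProductSpace ℂ H] [CompleteSpace H]

/-! ### A von Neumann algebra as an ordered C*-algebra

The algebraic operations, the norm and the order of a von Neumann algebra `M` on `H` are those
inherited from the bounded operators on `H`. -/

instance instSMulMemClass : SMulMemClass (VonNeumannAlgebra H) ℂ (H →L[ℂ] H) where
  smul_mem {S} c _ hx := S.toStarSubalgebra.smul_mem hx c

instance instIsClosed (M : VonNeumannAlgebra H) : IsClosed (M : Set (H →L[ℂ] H)) := by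
  rw [← M.centralizer_centralizer]
  exact Set.isClosed_centralizer _

/-- The order inherited from the Loewner order of operators makes `M` a star-ordered ring: the
square root of a positive element of `M` lies in the double commutant of `M`, hence in `M`. -/
instance instStarOrderedRing (M : VonNeumannAlgebra H) : StarOrderedRing M := by
  refine StarOrderedRing.of_le_iff fun a b => ⟨fun hab => ?_, ?_⟩
  · have h0 : (0 : H →L[ℂ] H) ≤ (b : H →L[ℂ] H) - a := sub_nonneg.mpr hab
    have hmem : CFC.sqrt ((b : H →L[ℂ] H) - a) ∈ M := by
      have hba : (b : H →L[ℂ] H) - a ∈ M := sub_mem b.2 a.2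
      rw [← SetLike.mem_coe, ← M.centralizer_centralizer, Set.mem_centralizer_iff]
      intro g hg
      have hc : Commute ((b : H →L[ℂ] H) - a) g := (Set.mem_centralizer_iff.mp hg _ hba)
      rw [CFC.sqrt_eq_cfc]
      exact (hc.cfc_nnreal _).symm.eq
    refine ⟨⟨_, hmem⟩, Subtype.ext ?_⟩
    have hs : star (CFC.sqrt ((b : H →L[ℂ] H) - a)) = CFC.sqrt ((b : H →L[ℂ] H) - a) :=
      (IsSelfAdjoint.of_nonneg (CFC.sqrt_nonneg _)).star_eq
    have := CFC.sqrt_mul_sqrt_self ((b : H →L[ℂ] H) - a) h0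
    simp [hs, this]
  · rintro ⟨s, rfl⟩
    have h0 : (0 : H →L[ℂ] H) ≤ star (s : H →L[ℂ] H) * s := star_mul_self_nonneg _
    have : (a : H →L[ℂ] H) ≤ (a : H →L[ℂ] H) + star (s : H →L[ℂ] H) * s :=
      le_add_of_nonneg_right h0
    exact this

/-- The von Neumann algebra generated by a set `s` of bounded operators: the double commutant of
`s ∪ s*`. -/
def generated (s : Set (H →L[ℂ] H)) : VonNeumannAlgebra H where
  toStarSubalgebra := StarSubalgebra.centralizer ℂ (StarSubalgebra.centralizer ℂ s : Set (H →L[ℂ] H))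
  centralizer_centralizer' := by
    change Set.centralizer (Set.centralizer
      ((StarSubalgebra.centralizer ℂ (StarSubalgebra.centralizer ℂ s : Set (H →L[ℂ] H)) :
        StarSubalgebra ℂ (H →L[ℂ] H)) : Set (H →L[ℂ] H))) = _
    rw [StarSubalgebra.coe_centralizer_centralizer, Set.centralizer_centralizer_centralizer]
    exact (StarSubalgebra.coe_centralizer_centralizer ℂ s).symm

lemma subset_generated (s : Set (H →L[ℂ] H)) : s ⊆ (generated s : Set (H →L[ℂ] H)) := by
  change s ⊆ ((StarSubalgebra.centralizer ℂ (StarSubalgebra.centralizer ℂ s : Set (H →L[ℂ] H)) :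
        StarSubalgebra ℂ (H →L[ℂ] H)) : Set (H →L[ℂ] H))
  rw [StarSubalgebra.coe_centralizer_centralizer]
  exact Set.subset_union_left.trans Set.subset_centralizer_centralizer

/-- The weak (i.e. ultraweak, σ-weak) topology of a von Neumann algebra: the coarsest one for which
all functionals `X ↦ ∑ₙ ⟨ξₙ, X ηₙ⟩` with `∑ₙ ‖ξₙ‖² < ∞` and `∑ₙ ‖ηₙ‖² < ∞` are continuous. -/
@[reducible]
def ultraweak (M : VonNeumannAlgebra H) : TopologicalSpace M :=
  ⨅ (ξ : lp (fun _ : ℕ => H) 2) (η : lp (fun _ : ℕ => H) 2),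
    TopologicalSpace.induced
      (fun X : M => ∑' n, inner ℂ (ξ n) ((X : H →L[ℂ] H) (η n))) inferInstance

end Algebra

section Tensor

variable {H : Type u} [NormedAddCommGroup H] [InnerProductSpace ℂ H]
variable {K : Type v} [NormedAddCommGroup K] [InnerProductSpace ℂ K]

/-- The Hilbert space tensor product: the completion of the algebraic one. -/
abbrev HTensor (H : Type u) [NormedAddCommGroup H] [InnerProductSpace ℂ H]
    (K : Type v) [NormedAddCommGroup K] [InnerProductSpace ℂ K] : Type (max u v) :=
  UniformSpace.Completion (H ⊗[ℂ] K)

/-- The bounded operator `a ⊗ b` on the Hilbert space tensor product. -/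
def opTensor (a : H →L[ℂ] H) (b : K →L[ℂ] K) : HTensor H K →L[ℂ] HTensor H K :=
  (TensorProduct.mapL a b).completion

lemma opTensor_add_left (a a' : H →L[ℂ] H) (b : K →L[ℂ] K) :
    opTensor (a + a') b = opTensor a b + opTensor a' b := by
  refine ContinuousLinearMap.ext fun x => ?_
  induction x using UniformSpace.Completion.induction_on with
  | hp => exact isClosed_eq (ContinuousLinearMap.continuous _) (ContinuousLinearMap.continuous _)
  | ih x => simp [opTensor, TensorProduct.map_add_left, UniformSpace.Completion.coe_add]

lemma opTensor_smul_left (c : ℂ) (a : H →L[ℂ] H) (b : K →L[ℂ] K) :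
    opTensor (c • a) b = c • opTensor a b := by
  refine ContinuousLinearMap.ext fun x => ?_
  induction x using UniformSpace.Completion.induction_on with
  | hp => exact isClosed_eq (ContinuousLinearMap.continuous _) (ContinuousLinearMap.continuous _)
  | ih x => simp [opTensor, TensorProduct.map_smul_left, UniformSpace.Completion.coe_smul]

variable [CompleteSpace H] [CompleteSpace K]

/-- The von Neumann algebra tensor product `M ⊗ N`, generated by the operators `a ⊗ b` with
`a ∈ M` and `b ∈ N`. -/
def vnTensor (M : VonNeumannAlgebra H) (N : VonNeumannAlgebra K) :
    VonNeumannAlgebra (HTensor H K) :=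
  generated {X | ∃ a ∈ M, ∃ b ∈ N, X = opTensor a b}

/-- The element `a ⊗ b` of `M ⊗ N`. -/
def tmul {M : VonNeumannAlgebra H} {N : VonNeumannAlgebra K} (a : M) (b : N) : vnTensor M N :=
  ⟨opTensor a b, subset_generated _ ⟨a, a.2, b, b.2, rfl⟩⟩

/-- The embedding `a ↦ a ⊗ 1` of `M` into `M ⊗ N`. -/
def inclLeft (M : VonNeumannAlgebra H) (N : VonNeumannAlgebra K) : M →ₗ[ℂ] vnTensor M N where
  toFun a := tmul a 1
  map_add' a b := by
    apply Subtype.ext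
    exact opTensor_add_left (a : H →L[ℂ] H) (b : H →L[ℂ] H) ((1 : N) : K →L[ℂ] K)
  map_smul' c a := by
    apply Subtype.ext
    rw [RingHom.id_apply, SetLike.val_smul]
    exact opTensor_smul_left c (a : H →L[ℂ] H) ((1 : N) : K →L[ℂ] K)

/-- A CP-map `T : M → N` between von Neumann algebras: a completely positive linear map that is
normalized, `T 1 = 1`, and weakly continuous. -/
structure CPMap (M : VonNeumannAlgebra H) (N : VonNeumannAlgebra K) extends M →CP N where
  map_one' : toFun 1 = 1
  continuous' : @Continuous M N (ultraweak M) (ultraweak N) toFun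

instance {M : VonNeumannAlgebra H} {N : VonNeumannAlgebra K} :
    CoeFun (CPMap M N) fun _ => M → N where
  coe T := T.toLinearMap

/-- The operator-valued form `(X, Y) = T(X† Y) - T(X)† T(Y)` of a CP-map `T`. -/
def CPMap.form {M : VonNeumannAlgebra H} {N : VonNeumannAlgebra K} (T : CPMap M N) (X Y : M) : N :=
  T (star X * Y) - star (T X) * T Y

/-- `Σ = ‖(X, X)‖^(1/2)`, the square root of the maximal added variance for the pointer `X`. -/
def CPMap.sigma {M : VonNeumannAlgebra H} {N : VonNeumannAlgebra K} (T : CPMap M N) (X : M) : ℝ :=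
  √‖T.form X X‖

/-- The restriction `R : M → M`, `R a = T(a ⊗ 1)`, of a map `T : M ⊗ N → M`. Its dual `R*` on
linear functionals is `T.restr.dualMap`, given by `R* ω = ω ∘ R`. -/
def CPMap.restr {M : VonNeumannAlgebra H} {N : VonNeumannAlgebra K} (T : CPMap (vnTensor M N) M) :
    M →ₗ[ℂ] M :=
  T.toLinearMap ∘ₗ inclLeft M N

/-- The density matrix `|φ⟩⟨φ|`, seen as the functional `X ↦ tr(|φ⟩⟨φ| X) = ⟨φ, X φ⟩` on `M`. -/
def ketbra (M : VonNeumannAlgebra H) (φ : H) : Module.Dual ℂ M where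
  toFun X := inner ℂ φ ((X : H →L[ℂ] H) φ)
  map_add' X Y := by simp
  map_smul' c X := by simp

/-- The trace distance `D(τ, ρ) = sup_P |τ(P) - ρ(P)|`, with `P` running over the projections
of `M`. -/
def traceDist {M : VonNeumannAlgebra H} (τ ρ : Module.Dual ℂ M) : ℝ≥0∞ :=
  ⨆ (P : M) (_ : IsStarProjection P), ‖τ P - ρ P‖ₑ

end Tensor

end QTransfer

end

open QTransfer

/-! Write `p = P ⊗ 1` and `b = 1 ⊗ B` for a projection `P`. On `P`, the two states differ only in
the cross terms, which involve the coherence `q = ⟨ψ, T(p) φ⟩` with weight at most `2|α||β| ≤ 1`. So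
it suffices to bound `‖q‖`.

Since `p` and `b` commute, `T(pb) = T(bp)` cancels in `(p,b) - (b,p)`, leaving the commutator of
`T(b)` and `T(p)`. Between eigenvectors of `T(b)` this equals `(x - y) q`. Complete positivity gives
Cauchy–Schwarz for the form (`CPMap.norm_inner_form_sq_le`), so each term is controlled by `Σ²` and
the variance of `p`. That variance is at most `1/4 - ‖q‖²` (`CPMap.inner_form_self_re_le`): a large
coherence leaves little variance. Hence `‖x - y‖² ‖q‖² ≤ Σ² (1 - 4‖q‖²)`, and solving for `‖q‖`
gives the bound (`CPMap.norm_inner_map_projection_le`).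

Equality is attained on qubits by compressing with `e i ↦ e i ⊗ k i`, which multiplies coherences by
the overlap of the pointer states `k 0` and `k 1`, while a reflection serves as the pointer
observable. -/

noncomputable section

namespace QTransfer

/-! ### Negative parts in C*-algebras -/

section NegPart

variable {E : Type*} [NonUnitalCStarAlgebra E] [PartialOrder E] [StarOrderedRing E]

lemma exists_eq_star_mul_self {a : E} (ha : 0 ≤ a) : ∃ l : E, a = star l * l :=
  CStarAlgebra.nonneg_iff_eq_star_mul_self.mp ha

/-- The negative part `c = l† l` of a self-adjoint element `a`; if `l c = 0` then `c = 0`, so that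
`a` is positive. -/
lemma exists_negPart {a : E} (ha : IsSelfAdjoint a) :
    ∃ c l : E, c = star l * l ∧ a * c = -(c * c) ∧ (l * c = 0 → 0 ≤ a) := by
  obtain ⟨l, hl⟩ := exists_eq_star_mul_self (CFC.negPart_nonneg a)
  refine ⟨a⁻, l, hl, ?_, fun h => ?_⟩
  · conv_lhs => enter [1]; rw [← CFC.posPart_sub_negPart a ha]
    rw [sub_mul, CFC.posPart_mul_negPart, zero_sub]
  · have hs : star a⁻ = a⁻ := (IsSelfAdjoint.of_nonneg (CFC.negPart_nonneg a)).star_eq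
    rw [← CFC.negPart_eq_zero_iff a ha, ← CStarRing.star_mul_self_eq_zero_iff, hs]
    nth_rw 1 [hl]
    rw [mul_assoc, h, mul_zero]

end NegPart

/-! ### Matrices over a von Neumann algebra acting on tuples of vectors -/

section MatrixAction

variable {H : Type u} [NormedAddCommGroup H] [InnerProductSpace ℂ H] [CompleteSpace H]
variable {M : VonNeumannAlgebra H} {n : Type*} [Fintype n]

/-- The action of a matrix of operators on a tuple of vectors. -/
def matrixAct (S : CStarMatrix n n M) (ξ : n → H) : n → H :=
  fun i => ∑ j, (S i j : H →L[ℂ] H) (ξ j)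

lemma matrixAct_mul (S S' : CStarMatrix n n M) (ξ : n → H) :
    matrixAct (S * S') ξ = matrixAct S (matrixAct S' ξ) := by
  funext i
  simp only [matrixAct, CStarMatrix.mul_apply, map_sum, AddSubmonoidClass.coe_finsetSum,
    MulMemClass.coe_mul, sum_apply, mul_apply_eq_comp]
  exact Finset.sum_comm

lemma matrixAct_neg (S : CStarMatrix n n M) (ξ : n → H) : matrixAct (-S) ξ = -matrixAct S ξ := by
  funext i
  simp [matrixAct]

lemma inner_coe_star_apply (a : M) (ξ η : H) :
    inner ℂ (((star a : M) : H →L[ℂ] H) ξ) η = inner ℂ ξ ((a : H →L[ℂ] H) η) := by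
  change inner ℂ ((star (a : H →L[ℂ] H)) ξ) η = _
  rw [ContinuousLinearMap.star_eq_adjoint, ContinuousLinearMap.adjoint_inner_left]

lemma inner_coe_apply (a : M) (ξ η : H) :
    inner ℂ ((a : H →L[ℂ] H) ξ) η = inner ℂ ξ (((star a : M) : H →L[ℂ] H) η) := by
  rw [← inner_coe_star_apply, star_star]

lemma sum_inner_matrixAct (S : CStarMatrix n n M) (ξ η : n → H) :
    ∑ i, inner ℂ (ξ i) (matrixAct (star S) η i) = ∑ i, inner ℂ (matrixAct S ξ i) (η i) := by
  simp only [matrixAct, inner_sum, sum_inner, CStarMatrix.star_apply]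
  rw [Finset.sum_comm]
  simp only [inner_coe_apply (S _ _)]

lemma sum_inner_matrixAct_star_mul_self (S : CStarMatrix n n M) (ξ η : n → H) :
    ∑ i, inner ℂ (ξ i) (matrixAct (star S * S) η i) =
      inner ℂ (WithLp.toLp 2 (matrixAct S ξ)) (WithLp.toLp 2 (matrixAct S η)) := by
  rw [matrixAct_mul, sum_inner_matrixAct, PiLp.inner_apply]

lemma eq_zero_of_matrixAct_eq_zero [DecidableEq n] {S : CStarMatrix n n M}
    (h : ∀ ξ, matrixAct S ξ = 0) : S = 0 := by
  refine CStarMatrix.ext fun i j => Subtype.ext (ContinuousLinearMap.ext fun v => ?_)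
  have := congrFun (h (Pi.single j v)) i
  simp only [matrixAct, Pi.single_apply, Pi.zero_apply] at this
  rw [Finset.sum_eq_single j (by simp +contextual) (by simp)] at this
  simpa using this

/-- A self-adjoint matrix over a von Neumann algebra is positive as soon as its quadratic form
is nonnegative. -/
lemma cstarMatrix_nonneg_of_quadratic [DecidableEq n] {S : CStarMatrix n n M}
    (hS : IsSelfAdjoint S) (h : ∀ ξ : n → H, 0 ≤ (∑ i, inner ℂ (ξ i) (matrixAct S ξ i)).re) :
    0 ≤ S := by
  obtain ⟨N, L, hL, hSN, hpos⟩ := exists_negPart hS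
  refine hpos ?_
  refine eq_zero_of_matrixAct_eq_zero fun ξ => ?_
  -- Testing on the range of the negative part turns the form into `-‖L N ξ‖²`, which is nonnegative
  -- only if `L N ξ = 0`.
  have h1 := h (matrixAct N ξ)
  rw [← matrixAct_mul, hSN, matrixAct_neg, matrixAct_mul] at h1
  nth_rw 2 [hL] at h1
  simp only [Pi.neg_apply, inner_neg_right, Finset.sum_neg_distrib] at h1
  rw [sum_inner_matrixAct_star_mul_self, inner_self_eq_norm_sq_to_K, ← matrixAct_mul] at h1
  have h2 : ‖WithLp.toLp 2 (matrixAct (L * N) ξ)‖ ^ 2 ≤ 0 := by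
    have : -(‖WithLp.toLp 2 (matrixAct (L * N) ξ)‖ ^ 2) ≥ 0 := by exact_mod_cast h1
    linarith
  have h3 : WithLp.toLp 2 (matrixAct (L * N) ξ) = 0 :=
    norm_eq_zero.mp (pow_eq_zero_iff two_ne_zero |>.mp (le_antisymm h2 (sq_nonneg _)))
  simpa using h3

end MatrixAction

/-! ### Cauchy–Schwarz for the form of a CP-map -/

section Form

variable {H : Type u} [NormedAddCommGroup H] [InnerProductSpace ℂ H] [CompleteSpace H]
variable {K : Type v} [NormedAddCommGroup K] [InnerProductSpace ℂ K] [CompleteSpace K]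
variable {M : VonNeumannAlgebra H} {N : VonNeumannAlgebra K}

lemma CPMap.map_one (T : CPMap M N) : T 1 = 1 := T.map_one'

/-- The Gram matrix `T(Zᵢ† Zⱼ)` of a CP-map is of the form `S† S`. -/
lemma CPMap.exists_gram (T : CPMap M N) {k : ℕ} (Z : Fin k → M) :
    ∃ S : CStarMatrix (Fin k) (Fin k) N, ∀ i j, (star S * S) i j = T (star (Z i) * Z j) := by
  rcases k with _ | k
  · exact ⟨0, fun i => i.elim0⟩
  -- With the tuple `Z` as its only nonzero row, `G† G` is the Gram matrix of `Z`; complete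
  -- positivity carries its positivity over to `T`.
  obtain ⟨G, hG⟩ : ∃ G : CStarMatrix (Fin (k + 1)) (Fin (k + 1)) M,
      G = CStarMatrix.ofMatrix fun i j => if i = 0 then Z j else 0 := ⟨_, rfl⟩
  have hG' : ∀ i j, G i j = if i = 0 then Z j else 0 := by
    subst hG
    exact fun _ _ => rfl
  have hGG : ∀ i j, (star G * G) i j = star (Z i) * Z j := by
    intro i j
    rw [CStarMatrix.mul_apply, Finset.sum_eq_single 0]
    · simp [hG', CStarMatrix.star_apply]
    · intro l _ hl
      simp [hG', CStarMatrix.star_apply, hl]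
    · simp
  obtain ⟨S, hS⟩ := exists_eq_star_mul_self
    (T.map_cstarMatrix_nonneg' _ (star G * G) (star_mul_self_nonneg G))
  refine ⟨S, fun i j => ?_⟩
  rw [← hS, CStarMatrix.map_apply, hGG]

/-- The Gram matrix of `(1, X)` is self-adjoint, and its two off-diagonal entries are `T X` and `T
(star X)`. -/
lemma CPMap.map_star (T : CPMap M N) (X : M) : T (star X) = star (T X) := by
  obtain ⟨S, hS⟩ := T.exists_gram ![1, X]
  have h01 := hS 0 1
  have h10 := hS 1 0
  simp only [Matrix.cons_val_zero, Matrix.cons_val_one, star_one, one_mul, mul_one] at h01 h10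
  rw [← h01, ← h10, ← CStarMatrix.star_apply, star_mul, star_star]

/-- The operator-valued form of a CP-map is represented by inner products of vectors. -/
lemma CPMap.exists_inner_eq_form (T : CPMap M N) (X Y : M) (ψ φ : K) :
    ∃ a b : PiLp 2 (fun _ : Fin 3 => K),
      inner ℂ a b = inner ℂ ψ ((T.form X Y : K →L[ℂ] K) φ) ∧
      inner ℂ a a = inner ℂ ψ ((T.form X X : K →L[ℂ] K) ψ) ∧
      inner ℂ b b = inner ℂ φ ((T.form Y Y : K →L[ℂ] K) φ) := by
  obtain ⟨S, hS⟩ := T.exists_gram ![1, X, Y]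
  -- These tuples encode the centred elements `X - T(X)` and `Y - T(Y)`, applied to `ψ` and `φ`;
  -- expanding the Gram matrix between them and using `T 1 = 1` leaves the form.
  set u : Fin 3 → K := ![-((T X : K →L[ℂ] K) ψ), ψ, 0] with hu
  set v : Fin 3 → K := ![-((T Y : K →L[ℂ] K) φ), 0, φ] with hv
  have key : ∀ ξ η : Fin 3 → K,
      inner ℂ (WithLp.toLp 2 (matrixAct S ξ)) (WithLp.toLp 2 (matrixAct S η)) =
      ∑ i, ∑ j, inner ℂ (ξ i)
        ((T (star (![1, X, Y] i) * ![1, X, Y] j) : K →L[ℂ] K) (η j)) := by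
    intro ξ η
    simp only [← sum_inner_matrixAct_star_mul_self, matrixAct, inner_sum, hS]
  have huv := key u v
  have huu := key u u
  have hvv := key v v
  simp only [Fin.sum_univ_three, hu, hv, Matrix.cons_val, star_one, one_mul, mul_one, T.map_one,
    T.map_star, inner_neg_left, inner_neg_right, map_neg, inner_zero_left, inner_zero_right,
    map_zero, inner_coe_apply, OneMemClass.coe_one, one_apply_eq_self, neg_neg, add_zero]
    at huv huu hvv
  have hform : ∀ (A B : M) (a b : K), inner ℂ a ((T.form A B : K →L[ℂ] K) b) =
      inner ℂ a ((T (star A * B) : K →L[ℂ] K) b) -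
        inner ℂ a (((star (T A) : N) : K →L[ℂ] K) ((T B : K →L[ℂ] K) b)) := by
    intro A B a b
    rw [← inner_sub_right]
    rfl
  refine ⟨WithLp.toLp 2 (matrixAct S u), WithLp.toLp 2 (matrixAct S v), ?_, ?_, ?_⟩
  · rw [hform, huv]; ring
  · rw [hform, huu]; ring
  · rw [hform, hvv]; ring

lemma CPMap.inner_form_self_re_nonneg (T : CPMap M N) (X : M) (ψ : K) :
    0 ≤ (inner ℂ ψ ((T.form X X : K →L[ℂ] K) ψ)).re := by
  obtain ⟨a, -, -, h, -⟩ := T.exists_inner_eq_form X X ψ ψ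
  rw [← h]
  exact inner_self_nonneg (𝕜 := ℂ) (x := a)

/-- Cauchy–Schwarz for the operator-valued form of a CP-map. -/
lemma CPMap.norm_inner_form_sq_le (T : CPMap M N) (X Y : M) (ψ φ : K) :
    ‖inner ℂ ψ ((T.form X Y : K →L[ℂ] K) φ)‖ ^ 2 ≤
      (inner ℂ ψ ((T.form X X : K →L[ℂ] K) ψ)).re *
        (inner ℂ φ ((T.form Y Y : K →L[ℂ] K) φ)).re := by
  obtain ⟨a, b, hab, haa, hbb⟩ := T.exists_inner_eq_form X Y ψ φ
  rw [← hab, ← haa, ← hbb, inner_self_eq_norm_sq_to_K, inner_self_eq_norm_sq_to_K]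
  calc _ ≤ (‖a‖ * ‖b‖) ^ 2 := by gcongr; exact norm_inner_le_norm a b
    _ = _ := by rw [mul_pow]; norm_cast

end Form

/-! ### Algebra of the operators `a ⊗ b` -/

section OpTensor

variable {H : Type u} [NormedAddCommGroup H] [InnerProductSpace ℂ H]
variable {K : Type v} [NormedAddCommGroup K] [InnerProductSpace ℂ K]

lemma opTensor_coe (a : H →L[ℂ] H) (b : K →L[ℂ] K) (z : H ⊗[ℂ] K) :
    opTensor a b (z : HTensor H K) = ((TensorProduct.mapL a b z : H ⊗[ℂ] K) : HTensor H K) := by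
  simp [opTensor]

lemma opTensor_coe_tmul (a : H →L[ℂ] H) (b : K →L[ℂ] K) (h : H) (k : K) :
    opTensor a b ((h ⊗ₜ[ℂ] k : H ⊗[ℂ] K) : HTensor H K) =
      ((a h ⊗ₜ[ℂ] b k : H ⊗[ℂ] K) : HTensor H K) := by
  rw [opTensor_coe, TensorProduct.mapL_tmul]

lemma opTensor_mul (a a' : H →L[ℂ] H) (b b' : K →L[ℂ] K) :
    opTensor a b * opTensor a' b' = opTensor (a * a') (b * b') := by
  refine ContinuousLinearMap.ext fun x => ?_
  induction x using UniformSpace.Completion.induction_on with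
  | hp => exact isClosed_eq (ContinuousLinearMap.continuous _) (ContinuousLinearMap.continuous _)
  | ih x => rw [mul_apply_eq_comp, opTensor_coe, opTensor_coe, opTensor_coe,
      TensorProduct.mapL_mul, mul_apply_eq_comp]

lemma opTensor_one : opTensor (1 : H →L[ℂ] H) (1 : K →L[ℂ] K) = 1 := by
  refine ContinuousLinearMap.ext fun x => ?_
  induction x using UniformSpace.Completion.induction_on with
  | hp => exact isClosed_eq (ContinuousLinearMap.continuous _) (ContinuousLinearMap.continuous _)
  | ih x =>
    rw [opTensor_coe]
    exact congrArg _ (congrArg (fun f => f x) (TensorProduct.mapL_id_id (𝕜 := ℂ) (E := H) (G := K)))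

variable [CompleteSpace H] [CompleteSpace K]

lemma inner_mapL_left (a : H →L[ℂ] H) (b : K →L[ℂ] K) (z w : H ⊗[ℂ] K) :
    inner ℂ (TensorProduct.mapL (star a) (star b) z) w = inner ℂ z (TensorProduct.mapL a b w) := by
  induction z using TensorProduct.induction_on with
  | zero => simp
  | add z₁ z₂ h₁ h₂ => rw [map_add, inner_add_left, inner_add_left, h₁, h₂]
  | tmul h k =>
    induction w using TensorProduct.induction_on with
    | zero => simp
    | add w₁ w₂ h₁ h₂ => rw [map_add, inner_add_right, inner_add_right, h₁, h₂]
    | tmul h' k' =>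
      rw [TensorProduct.mapL_tmul, TensorProduct.mapL_tmul, TensorProduct.inner_tmul,
        TensorProduct.inner_tmul, ContinuousLinearMap.star_eq_adjoint,
        ContinuousLinearMap.star_eq_adjoint, ContinuousLinearMap.adjoint_inner_left,
        ContinuousLinearMap.adjoint_inner_left]

lemma star_opTensor (a : H →L[ℂ] H) (b : K →L[ℂ] K) :
    star (opTensor a b) = opTensor (star a) (star b) := by
  rw [ContinuousLinearMap.star_eq_adjoint]
  symm
  rw [ContinuousLinearMap.eq_adjoint_iff]
  intro x y
  induction x, y using UniformSpace.Completion.induction_on₂ with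
  | hp => exact isClosed_eq (by fun_prop) (by fun_prop)
  | ih x y =>
    rw [opTensor_coe, opTensor_coe, UniformSpace.Completion.inner_coe,
      UniformSpace.Completion.inner_coe, inner_mapL_left]

variable {M : VonNeumannAlgebra H} {N : VonNeumannAlgebra K}

lemma tmul_mul (a a' : M) (b b' : N) : tmul a b * tmul a' b' = tmul (a * a') (b * b') :=
  Subtype.ext (opTensor_mul _ _ _ _)

lemma star_tmul (a : M) (b : N) : star (tmul a b) = tmul (star a) (star b) :=
  Subtype.ext (star_opTensor _ _)

lemma tmul_one_one : tmul (1 : M) (1 : N) = 1 :=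
  Subtype.ext opTensor_one

end OpTensor

/-! ### The decoherence bound -/

section Bound

variable {H : Type u} [NormedAddCommGroup H] [InnerProductSpace ℂ H] [CompleteSpace H]
variable {K : Type v} [NormedAddCommGroup K] [InnerProductSpace ℂ K]

/-- Bessel's inequality for two vectors. -/
lemma norm_inner_sq_add_norm_inner_sq_le {ψ φ : K} (hψ : ‖ψ‖ = 1) (hφ : ‖φ‖ = 1)
    (h : inner ℂ ψ φ = 0) (v : K) : ‖inner ℂ ψ v‖ ^ 2 + ‖inner ℂ φ v‖ ^ 2 ≤ ‖v‖ ^ 2 := by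
  have ho : Orthonormal ℂ ![ψ, φ] := by
    rw [orthonormal_iff_ite]
    intro i j
    fin_cases i <;> fin_cases j <;>
      simp [h, inner_eq_zero_symm.mp h, inner_self_eq_norm_sq_to_K, hψ, hφ]
  simpa [Fin.sum_univ_two] using ho.sum_inner_products_le (x := v) (s := Finset.univ)

variable [CompleteSpace K]
variable {M : VonNeumannAlgebra H} {N : VonNeumannAlgebra K}

/-- Eigenvalues enter the theorem as complex numbers, so their reality has to be derived. -/
lemma conj_eq_of_eigenvector {A : N} (hA : star A = A) {x : ℂ} {ψ : K} (hψ : ‖ψ‖ = 1)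
    (h : (A : K →L[ℂ] K) ψ = x • ψ) : star x = x := by
  have h1 := inner_coe_apply A ψ ψ
  rw [hA, h, inner_smul_left, inner_smul_right, inner_self_eq_norm_sq_to_K, hψ] at h1
  simpa using h1

lemma inner_eq_zero_of_eigenvectors {A : N} (hA : star A = A) {x y : ℂ} {ψ φ : K} (hψ : ‖ψ‖ = 1)
    (h : (A : K →L[ℂ] K) ψ = x • ψ) (h' : (A : K →L[ℂ] K) φ = y • φ) (hxy : x ≠ y) :
    inner ℂ ψ φ = 0 := by
  have h1 := inner_coe_apply A ψ φ
  have hx : (starRingEnd ℂ) x = x := conj_eq_of_eigenvector hA hψ h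
  rw [hA, h, h', inner_smul_left, inner_smul_right, hx] at h1
  exact (mul_eq_mul_right_iff.mp h1).resolve_left hxy

/-- As `P² = P`, the left side is `m - ‖T(P)ψ‖²` with `m = ⟨ψ, T(P)ψ⟩`. Bessel bounds `‖T(P)ψ‖²`
below by `m²` plus the squared coherence, and `m - m² ≤ 1/4`. -/
lemma CPMap.inner_form_self_re_le (T : CPMap M N) {P : M} (hP : IsStarProjection P) {ψ φ : K}
    (hψ : ‖ψ‖ = 1) (hφ : ‖φ‖ = 1) (h : inner ℂ ψ φ = 0) :
    (inner ℂ ψ ((T.form P P : K →L[ℂ] K) ψ)).re ≤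
      1 / 4 - ‖inner ℂ φ ((T P : K →L[ℂ] K) ψ)‖ ^ 2 := by
  have hs : star (T P) = T P := by rw [← T.map_star, hP.isSelfAdjoint.star_eq]
  have hB := norm_inner_sq_add_norm_inner_sq_le hψ hφ h ((T P : K →L[ℂ] K) ψ)
  have e : inner ℂ ψ ((T.form P P : K →L[ℂ] K) ψ) = inner ℂ ψ ((T P : K →L[ℂ] K) ψ) -
      inner ℂ ((T P : K →L[ℂ] K) ψ) ((T P : K →L[ℂ] K) ψ) := by
    rw [inner_coe_apply, ← inner_sub_right, CPMap.form, hP.isSelfAdjoint.star_eq,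
      hP.isIdempotentElem.eq]
    rfl
  have h2 : (inner ℂ ψ ((T P : K →L[ℂ] K) ψ)).re ^ 2 ≤
      ‖inner ℂ ψ ((T P : K →L[ℂ] K) ψ)‖ ^ 2 := by
    rw [← sq_abs]
    gcongr
    exact Complex.abs_re_le_norm _
  have h3 : (inner ℂ ((T P : K →L[ℂ] K) ψ) ((T P : K →L[ℂ] K) ψ)).re =
      ‖(T P : K →L[ℂ] K) ψ‖ ^ 2 := by
    rw [inner_self_eq_norm_sq_to_K]; norm_cast
  rw [e, Complex.sub_re, h3]
  nlinarith [sq_nonneg ((inner ℂ ψ ((T P : K →L[ℂ] K) ψ)).re - 1 / 2)]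

lemma CPMap.inner_form_self_re_le_sigma_sq (T : CPMap M N) (B : M) {φ : K} (hφ : ‖φ‖ = 1) :
    (inner ℂ φ ((T.form B B : K →L[ℂ] K) φ)).re ≤ T.sigma B ^ 2 := by
  rw [CPMap.sigma, Real.sq_sqrt (norm_nonneg _)]
  calc _ ≤ ‖inner ℂ φ ((T.form B B : K →L[ℂ] K) φ)‖ := Complex.re_le_norm _
    _ ≤ ‖φ‖ * ‖(T.form B B : K →L[ℂ] K) φ‖ := norm_inner_le_norm _ _
    _ ≤ ‖φ‖ * (‖(T.form B B : K →L[ℂ] K)‖ * ‖φ‖) := by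
      gcongr; exact ContinuousLinearMap.le_opNorm _ _
    _ = ‖T.form B B‖ := by rw [hφ, one_mul, mul_one]; rfl

/-- The coherence between two eigenvectors of `T B` which survives in `T P`, for a projection `P`
commuting with `B`. -/
lemma CPMap.norm_inner_map_projection_le (T : CPMap M N) {P B : M} (hP : IsStarProjection P)
    (hB : IsSelfAdjoint B) (hPB : P * B = B * P) {x y : ℂ} (hxy : x ≠ y) {ψ φ : K}
    (hψ : ‖ψ‖ = 1) (hφ : ‖φ‖ = 1) (hx : (T B : K →L[ℂ] K) ψ = x • ψ)
    (hy : (T B : K →L[ℂ] K) φ = y • φ) :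
    ‖inner ℂ ψ ((T P : K →L[ℂ] K) φ)‖ ≤
      (T.sigma B / ‖x - y‖) / √(1 + 4 * (T.sigma B / ‖x - y‖) ^ 2) := by
  have hsP : star (T P) = T P := by rw [← T.map_star, hP.isSelfAdjoint.star_eq]
  have hsB : star (T B) = T B := by rw [← T.map_star, hB.star_eq]
  have horth := inner_eq_zero_of_eigenvectors hsB hψ hx hy hxy
  have hxr : (starRingEnd ℂ) x = x := conj_eq_of_eigenvector hsB hψ hx
  set q := inner ℂ ψ ((T P : K →L[ℂ] K) φ) with hq
  have hq' : ‖inner ℂ φ ((T P : K →L[ℂ] K) ψ)‖ = ‖q‖ := by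
    rw [hq, ← inner_conj_symm, inner_coe_apply, hsP, RCLike.norm_conj]
  -- The terms `T(PB)` and `T(BP)` agree and cancel, so only the commutator of `T B` and `T P`
  -- survives.
  have hcomm : inner ℂ ψ ((T.form P B : K →L[ℂ] K) φ) -
      inner ℂ ψ ((T.form B P : K →L[ℂ] K) φ) = (x - y) * q := by
    have e : inner ℂ ψ ((T.form P B : K →L[ℂ] K) φ) - inner ℂ ψ ((T.form B P : K →L[ℂ] K) φ) =
        inner ℂ ψ ((T B : K →L[ℂ] K) ((T P : K →L[ℂ] K) φ)) -
          inner ℂ ψ ((T P : K →L[ℂ] K) ((T B : K →L[ℂ] K) φ)) := by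
      rw [CPMap.form, CPMap.form, hP.isSelfAdjoint.star_eq, hB.star_eq, hPB, hsP, hsB,
        ← inner_sub_right, ← inner_sub_right]
      change inner ℂ ψ (((T (B * P) : K →L[ℂ] K) φ - (T P : K →L[ℂ] K) ((T B : K →L[ℂ] K) φ)) -
        ((T (B * P) : K →L[ℂ] K) φ - (T B : K →L[ℂ] K) ((T P : K →L[ℂ] K) φ))) = _
      congr 1
      abel
    have e2 := inner_coe_apply (T B) ψ ((T P : K →L[ℂ] K) φ)
    rw [hsB, hx, inner_smul_left, hxr] at e2
    rw [e, ← e2, hy, map_smul, inner_smul_right]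
    ring
  have hd : 0 < ‖x - y‖ := norm_pos_iff.mpr (sub_ne_zero.mpr hxy)
  have hσ : 0 ≤ T.sigma B := Real.sqrt_nonneg _
  have hf1 : ‖inner ℂ ψ ((T.form P B : K →L[ℂ] K) φ)‖ ^ 2 ≤
      (1 / 4 - ‖q‖ ^ 2) * T.sigma B ^ 2 :=
    (T.norm_inner_form_sq_le P B ψ φ).trans <| by
      have h1 := T.inner_form_self_re_le hP hψ hφ horth
      rw [hq'] at h1
      have h0 := T.inner_form_self_re_nonneg P ψ
      exact mul_le_mul h1 (T.inner_form_self_re_le_sigma_sq B hφ)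
        (T.inner_form_self_re_nonneg B φ) (h0.trans h1)
  have hf2 : ‖inner ℂ ψ ((T.form B P : K →L[ℂ] K) φ)‖ ^ 2 ≤
      T.sigma B ^ 2 * (1 / 4 - ‖q‖ ^ 2) :=
    (T.norm_inner_form_sq_le B P ψ φ).trans <| by
      have h1 := T.inner_form_self_re_le hP hφ hψ (inner_eq_zero_symm.mp horth)
      exact mul_le_mul (T.inner_form_self_re_le_sigma_sq B hψ) h1
        (T.inner_form_self_re_nonneg P φ) (sq_nonneg _)
  have htri : ‖x - y‖ * ‖q‖ ≤ ‖inner ℂ ψ ((T.form P B : K →L[ℂ] K) φ)‖ +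
      ‖inner ℂ ψ ((T.form B P : K →L[ℂ] K) φ)‖ := by
    rw [← norm_mul, ← hcomm]
    exact norm_sub_le _ _
  -- Uses `(a + b)² ≤ 2 (a² + b²)`, with both squares at most `Σ² (1/4 - ‖q‖²)`.
  have hsq : (‖x - y‖ * ‖q‖) ^ 2 ≤ T.sigma B ^ 2 * (1 - 4 * ‖q‖ ^ 2) := by
    have := pow_le_pow_left₀ (by positivity) htri 2
    nlinarith [sq_nonneg (‖inner ℂ ψ ((T.form P B : K →L[ℂ] K) φ)‖ -
      ‖inner ℂ ψ ((T.form B P : K →L[ℂ] K) φ)‖)]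
  obtain ⟨s, hs⟩ : ∃ s, s = T.sigma B / ‖x - y‖ := ⟨_, rfl⟩
  have hs0 : 0 ≤ s := hs ▸ div_nonneg hσ hd.le
  have hσs : T.sigma B = s * ‖x - y‖ := by rw [hs]; field_simp
  rw [← hs, le_div_iff₀ (by positivity)]
  refine abs_le_of_sq_le_sq' ?_ hs0 |>.2
  rw [mul_pow, Real.sq_sqrt (by positivity)]
  rw [hσs] at hsq
  have : ‖x - y‖ ^ 2 * (‖q‖ ^ 2 * (1 + 4 * s ^ 2)) ≤ ‖x - y‖ ^ 2 * s ^ 2 := by nlinarith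
  exact le_of_mul_le_mul_left this (by positivity)

/-- The diagonal terms of the superposition are exactly the mixture, so only interference remains.
-/
lemma ketbra_superposition_sub (α β : ℂ) (ψ φ : H) (X : M) :
    ketbra M (α • ψ + β • φ) X - (((‖α‖ ^ 2 : ℝ) : ℂ) • ketbra M ψ +
      ((‖β‖ ^ 2 : ℝ) : ℂ) • ketbra M φ) X =
    star α * β * inner ℂ ψ ((X : H →L[ℂ] H) φ) + star β * α * inner ℂ φ ((X : H →L[ℂ] H) ψ) := by
  have hα : ((‖α‖ ^ 2 : ℝ) : ℂ) = star α * α := by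
    push_cast; exact (RCLike.conj_mul α).symm
  have hβ : ((‖β‖ ^ 2 : ℝ) : ℂ) = star β * β := by
    push_cast; exact (RCLike.conj_mul β).symm
  rw [hα, hβ]
  simp only [ketbra, LinearMap.coe_mk, AddHom.coe_mk, LinearMap.add_apply, LinearMap.smul_apply,
    map_add, map_smul, inner_add_left, inner_add_right, inner_smul_left, inner_smul_right,
    smul_eq_mul, starRingEnd_apply]
  ring

/-- The decoherence bound. -/
theorem traceDist_restr_dualMap_le (T : CPMap (vnTensor M N) M) {B : N} (hB : IsSelfAdjoint B)
    {x y : ℂ} (hxy : x ≠ y) {ψ φ : H} (hψ : ‖ψ‖ = 1)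
    (hx : (T (tmul 1 B) : H →L[ℂ] H) ψ = x • ψ) (hφ : ‖φ‖ = 1)
    (hy : (T (tmul 1 B) : H →L[ℂ] H) φ = y • φ) {α β : ℂ} (hαβ : ‖α‖ ^ 2 + ‖β‖ ^ 2 = 1) :
    traceDist (T.restr.dualMap (ketbra M (α • ψ + β • φ)))
        (T.restr.dualMap
          (((‖α‖ ^ 2 : ℝ) : ℂ) • ketbra M ψ + ((‖β‖ ^ 2 : ℝ) : ℂ) • ketbra M φ)) ≤
      ENNReal.ofReal ((T.sigma (tmul 1 B) / ‖x - y‖) /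
        √(1 + 4 * (T.sigma (tmul 1 B) / ‖x - y‖) ^ 2)) := by
  refine iSup₂_le fun P hP => ?_
  rw [← ofReal_norm]
  refine ENNReal.ofReal_le_ofReal ?_
  have hPs := hP.isSelfAdjoint.star_eq
  have hP1 : IsStarProjection (tmul P (1 : N)) :=
    ⟨by rw [IsIdempotentElem, tmul_mul, hP.isIdempotentElem.eq, one_mul],
      by rw [isSelfAdjoint_iff, star_tmul, hPs, star_one]⟩
  have hB1 : IsSelfAdjoint (tmul (1 : M) B) := by
    rw [isSelfAdjoint_iff, star_tmul, hB.star_eq, star_one]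
  -- Here the tensor structure enters: system and pointer observables commute.
  have hc : tmul P (1 : N) * tmul (1 : M) B = tmul 1 B * tmul P 1 := by
    rw [tmul_mul, tmul_mul, one_mul, mul_one, one_mul, mul_one]
  have hq := T.norm_inner_map_projection_le hP1 hB1 hc hxy hψ hφ hx hy
  have hsP : star (T (tmul P (1 : N))) = T (tmul P 1) := by
    rw [← T.map_star, hP1.isSelfAdjoint.star_eq]
  have hq' : ‖inner ℂ φ ((T (tmul P (1 : N)) : H →L[ℂ] H) ψ)‖ =
      ‖inner ℂ ψ ((T (tmul P (1 : N)) : H →L[ℂ] H) φ)‖ := by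
    rw [← inner_conj_symm, inner_coe_apply, hsP, RCLike.norm_conj]
  refine le_trans ?_ hq
  rw [LinearMap.dualMap_apply, LinearMap.dualMap_apply, ketbra_superposition_sub]
  change ‖star α * β * inner ℂ ψ ((T (tmul P (1 : N)) : H →L[ℂ] H) φ) +
    star β * α * inner ℂ φ ((T (tmul P (1 : N)) : H →L[ℂ] H) ψ)‖ ≤ _
  refine (norm_add_le _ _).trans ?_
  -- Both cross terms have the same norm, so `2‖α‖‖β‖ ≤ ‖α‖² + ‖β‖² = 1` finishes.
  rw [norm_mul, norm_mul, norm_mul, norm_mul, norm_star, norm_star, hq']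
  nlinarith [norm_nonneg (inner ℂ ψ ((T (tmul P (1 : N)) : H →L[ℂ] H) φ)),
    sq_nonneg (‖α‖ - ‖β‖)]

end Bound

/-! ### Compressions by isometries are CP-maps -/

section Compression

variable {H : Type u} [NormedAddCommGroup H] [InnerProductSpace ℂ H]
variable {L : Type v} [NormedAddCommGroup L] [InnerProductSpace ℂ L]

lemma memℓp_isometry_comp (V : H →ₗᵢ[ℂ] L) (ξ : lp (fun _ : ℕ => H) 2) :
    Memℓp (E := fun _ : ℕ => L) (fun n => V (ξ n)) 2 := by
  refine memℓp_gen ?_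
  simpa using (lp.memℓp ξ).summable (by norm_num)

variable [CompleteSpace H] [CompleteSpace L]

/-- The compression `X ↦ V† X V` by an isometry `V`, as a linear map into an algebra `N` which
contains all operators. -/
def compressionLinear (M : VonNeumannAlgebra L) (N : VonNeumannAlgebra H) (hN : ∀ a, a ∈ N)
    (V : H →ₗᵢ[ℂ] L) : M →ₗ[ℂ] N where
  toFun X := ⟨ContinuousLinearMap.adjoint V.toContinuousLinearMap ∘L (X : L →L[ℂ] L) ∘L
    V.toContinuousLinearMap, hN _⟩
  map_add' X Y := by
    refine Subtype.ext (ContinuousLinearMap.ext fun v => ?_)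
    simp
  map_smul' c X := by
    refine Subtype.ext (ContinuousLinearMap.ext fun v => ?_)
    simp

lemma inner_compressionLinear (M : VonNeumannAlgebra L) (N : VonNeumannAlgebra H)
    (hN : ∀ a, a ∈ N) (V : H →ₗᵢ[ℂ] L) (X : M) (ξ η : H) :
    inner ℂ ξ ((compressionLinear M N hN V X : H →L[ℂ] H) η) =
      inner ℂ (V ξ) ((X : L →L[ℂ] L) (V η)) :=
  ContinuousLinearMap.adjoint_inner_right V.toContinuousLinearMap _ _

/-- The compression by an isometry, as a CP-map. -/
def compression (M : VonNeumannAlgebra L) (N : VonNeumannAlgebra H) (hN : ∀ a, a ∈ N)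
    (V : H →ₗᵢ[ℂ] L) : CPMap M N where
  toLinearMap := compressionLinear M N hN V
  map_cstarMatrix_nonneg' k G hG := by
    obtain ⟨S, hS⟩ := exists_eq_star_mul_self hG
    have hGs : star G = G := by rw [hS, star_mul, star_star]
    refine cstarMatrix_nonneg_of_quadratic ?_ fun ξ => ?_
    · refine CStarMatrix.ext fun i j => Subtype.ext (ContinuousLinearMap.ext fun v => ?_)
      refine ext_inner_left ℂ fun w => ?_
      have hij : G i j = star (G j i) := by rw [← CStarMatrix.star_apply, hGs]
      rw [CStarMatrix.star_apply, CStarMatrix.map_apply, CStarMatrix.map_apply, ← inner_coe_apply,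
        ← inner_conj_symm, inner_compressionLinear, inner_conj_symm, inner_coe_apply,
        inner_compressionLinear, hij]
    · have e : ∑ i, inner ℂ (ξ i) (matrixAct (G.map (compressionLinear M N hN V)) ξ i) =
          ∑ i, inner ℂ (V (ξ i)) (matrixAct G (fun j => V (ξ j)) i) := by
        simp only [matrixAct, inner_sum, CStarMatrix.map_apply, inner_compressionLinear]
      rw [e, hS, sum_inner_matrixAct_star_mul_self S (fun j => V (ξ j))]
      exact inner_self_nonneg (𝕜 := ℂ)
        (x := (WithLp.toLp 2 (matrixAct S fun j => V (ξ j)) : PiLp 2 fun _ : Fin k => L))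
  map_one' := by
    refine Subtype.ext (ContinuousLinearMap.ext fun v => ext_inner_left ℂ fun w => ?_)
    exact (inner_compressionLinear M N hN V 1 w v).trans (V.inner_map_map w v)
  continuous' := by
    refine continuous_iInf_rng.mpr fun ξ => continuous_iInf_rng.mpr fun η => ?_
    refine continuous_induced_rng.mpr ?_
    -- The functional of `(ξ, η)` pulls back to that of `(Vξ, Vη)`, which are again square-summable.
    refine continuous_iInf_dom (i := ⟨_, memℓp_isometry_comp V ξ⟩)
      (continuous_iInf_dom (i := ⟨_, memℓp_isometry_comp V η⟩) ?_)
    convert continuous_induced_dom using 1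
    funext X
    exact tsum_congr fun n => inner_compressionLinear M N hN V X (ξ n) (η n)

end Compression

/-! ### Copying a basis into a pointer -/

section Pointer

variable {H : Type u} [NormedAddCommGroup H] [InnerProductSpace ℂ H]
variable {K : Type v} [NormedAddCommGroup K] [InnerProductSpace ℂ K]
variable {ι : Type*} [Fintype ι]

/-- The isometry `b i ↦ b i ⊗ k i`, which correlates an orthonormal basis `b` with unit
vectors `k`. -/
def pointerIsometry (b : OrthonormalBasis ι ℂ H) (k : ι → K) (hk : ∀ i, ‖k i‖ = 1) :
    H →ₗᵢ[ℂ] HTensor H K :=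
  (b.toBasis.constr ℂ fun i => ((b i ⊗ₜ[ℂ] k i : H ⊗[ℂ] K) : HTensor H K)).isometryOfOrthonormal
    (v := b.toBasis) (by simp) (by
      classical
      rw [orthonormal_iff_ite]
      intro i j
      simp only [Function.comp_apply, Module.Basis.constr_basis, UniformSpace.Completion.inner_coe,
        TensorProduct.inner_tmul, orthonormal_iff_ite.mp b.orthonormal i j]
      split_ifs with h
      · subst h
        simp [inner_self_eq_norm_sq_to_K, hk]
      · simp)

lemma pointerIsometry_apply (b : OrthonormalBasis ι ℂ H) (k : ι → K) (hk : ∀ i, ‖k i‖ = 1)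
    (i : ι) : pointerIsometry b k hk (b i) = ((b i ⊗ₜ[ℂ] k i : H ⊗[ℂ] K) : HTensor H K) := by
  have := b.toBasis.constr_basis ℂ
    (fun i => ((b i ⊗ₜ[ℂ] k i : H ⊗[ℂ] K) : HTensor H K)) i
  rwa [b.coe_toBasis] at this

variable [CompleteSpace H] [CompleteSpace K]

/-- The transfer of information to a pointer: compression by the isometry `b i ↦ b i ⊗ k i`. -/
def pointerMap (M : VonNeumannAlgebra H) (N : VonNeumannAlgebra K) (hM : ∀ a, a ∈ M)
    (b : OrthonormalBasis ι ℂ H) (k : ι → K) (hk : ∀ i, ‖k i‖ = 1) : CPMap (vnTensor M N) M :=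
  compression _ M hM (pointerIsometry b k hk)

variable {M : VonNeumannAlgebra H} {N : VonNeumannAlgebra K} {hM : ∀ a, a ∈ M}
  {b : OrthonormalBasis ι ℂ H} {k : ι → K} {hk : ∀ i, ‖k i‖ = 1}

/-- Matrix entries multiply entrywise; for `c = 1` the coherences of `a` are damped by the overlaps
of the pointer states. -/
lemma inner_pointerMap (a : M) (c : N) (i j : ι) :
    inner ℂ (b i) ((pointerMap M N hM b k hk (tmul a c) : H →L[ℂ] H) (b j)) =
      inner ℂ (b i) ((a : H →L[ℂ] H) (b j)) * inner ℂ (k i) ((c : K →L[ℂ] K) (k j)) := by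
  refine (inner_compressionLinear _ M hM (pointerIsometry b k hk) (tmul a c) (b i) (b j)).trans ?_
  rw [pointerIsometry_apply, pointerIsometry_apply]
  change inner ℂ _ (opTensor (a : H →L[ℂ] H) (c : K →L[ℂ] K) _) = _
  rw [opTensor_coe_tmul, UniformSpace.Completion.inner_coe, TensorProduct.inner_tmul]

/-- For `a = 1` the factor `⟨b i, b j⟩` kills the off-diagonal entries, so the basis consists of
eigenvectors, with pointer expectations as eigenvalues. -/
lemma pointerMap_tmul_one_apply (c : N) (j : ι) :
    (pointerMap M N hM b k hk (tmul 1 c) : H →L[ℂ] H) (b j) =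
      inner ℂ (k j) ((c : K →L[ℂ] K) (k j)) • b j := by
  classical
  refine b.repr.injective (PiLp.ext fun i => ?_)
  rw [b.repr_apply_apply, b.repr_apply_apply, inner_pointerMap, inner_smul_right]
  change inner ℂ (b i) (b j) * _ = _
  rw [orthonormal_iff_ite.mp b.orthonormal]
  split_ifs with h
  · rw [h, mul_comm]
  · simp

/-- If the pointer observable `c` satisfies `c² = 1` and has expectation `± r` in all pointer
states, then the added variance is `1 - r²`. -/
lemma sigma_pointerMap [Nontrivial H] {c : N} (hc : star c * c = 1) (hcs : IsSelfAdjoint c) {r : ℝ}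
    (hr : ∀ i, inner ℂ (k i) ((c : K →L[ℂ] K) (k i)) ^ 2 = (r : ℂ) ^ 2) :
    (pointerMap M N hM b k hk).sigma (tmul 1 c) = √|1 - r ^ 2| := by
  set T := pointerMap M N hM b k hk
  have hs : star (T (tmul (1 : M) c)) = T (tmul 1 c) := by
    rw [← T.map_star, star_tmul, hcs.star_eq, star_one]
  have hf : (T.form (tmul 1 c) (tmul 1 c) : H →L[ℂ] H) = ((1 - r ^ 2 : ℝ) : ℂ) • 1 := by
    -- As `c² = 1`, the form is `1 - T(1 ⊗ c)²`, which is scalar because all eigenvalues square to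
    -- `r²`.
    have e : T.form (tmul 1 c) (tmul 1 c) = 1 - T (tmul 1 c) * T (tmul 1 c) := by
      rw [CPMap.form, hs, star_tmul, tmul_mul, hc, star_one, one_mul, tmul_one_one, T.map_one]
    rw [e]
    refine ContinuousLinearMap.coe_injective (b.toBasis.ext fun j => ?_)
    rw [b.coe_toBasis]
    change b j - (T (tmul 1 c) : H →L[ℂ] H) ((T (tmul 1 c) : H →L[ℂ] H) (b j)) =
      ((1 - r ^ 2 : ℝ) : ℂ) • b j
    rw [pointerMap_tmul_one_apply, map_smul, pointerMap_tmul_one_apply, smul_smul, ← sq, hr]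
    push_cast
    rw [sub_smul, one_smul]
  have hn : ‖T.form (tmul 1 c) (tmul 1 c)‖ = |1 - r ^ 2| := by
    change ‖(T.form (tmul 1 c) (tmul 1 c) : H →L[ℂ] H)‖ = _
    rw [hf, norm_smul, norm_one, mul_one, Complex.norm_real, Real.norm_eq_abs]
  rw [CPMap.sigma, hn]

end Pointer

/-! ### The extremal qubit example -/

section Qubit

/-- The algebra of all bounded operators. -/
def allOperators (H : Type u) [NormedAddCommGroup H] [InnerProductSpace ℂ H] [CompleteSpace H] :
    VonNeumannAlgebra H := generated Set.univ

lemma mem_allOperators {H : Type u} [NormedAddCommGroup H] [InnerProductSpace ℂ H]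
    [CompleteSpace H] (a : H →L[ℂ] H) : a ∈ allOperators H :=
  subset_generated _ (Set.mem_univ a)

/-- The state space of a qubit. -/
abbrev Qubit : Type := EuclideanSpace ℂ (Fin 2)

/-- The operator on a qubit with a given matrix. -/
def qubitOp (A : Matrix (Fin 2) (Fin 2) ℂ) : allOperators Qubit :=
  ⟨Matrix.toEuclideanCLM (n := Fin 2) (𝕜 := ℂ) A, mem_allOperators _⟩

lemma qubitOp_mul (A B : Matrix (Fin 2) (Fin 2) ℂ) : qubitOp A * qubitOp B = qubitOp (A * B) :=
  Subtype.ext (map_mul (Matrix.toEuclideanCLM (n := Fin 2) (𝕜 := ℂ)) A B).symm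

lemma star_qubitOp (A : Matrix (Fin 2) (Fin 2) ℂ) : star (qubitOp A) = qubitOp (star A) :=
  Subtype.ext (map_star (Matrix.toEuclideanCLM (n := Fin 2) (𝕜 := ℂ)) A).symm

lemma qubitOp_one : qubitOp 1 = 1 :=
  Subtype.ext (map_one (Matrix.toEuclideanCLM (n := Fin 2) (𝕜 := ℂ)))

lemma inner_qubitOp (A : Matrix (Fin 2) (Fin 2) ℂ) (v w : Qubit) :
    inner ℂ v ((qubitOp A : Qubit →L[ℂ] Qubit) w) =
      ∑ i, (∑ j, A i j * w j) * star (v i) := by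
  rw [PiLp.inner_apply]
  rfl

/-- The pointer states, with overlap `S`. -/
def pointerState (C S : ℝ) : Fin 2 → Qubit := ![!₂[1, 0], !₂[(S : ℂ), (C : ℂ)]]

/-- The pointer observable, a reflection. -/
def pointerObservable (C S : ℝ) : allOperators Qubit :=
  qubitOp !![(C : ℂ), -(S : ℂ); -(S : ℂ), -(C : ℂ)]

/-- The projection onto the diagonal of `ℂ²`. -/
def diagonalProjection : allOperators Qubit :=
  qubitOp !![1 / 2, 1 / 2; 1 / 2, 1 / 2]

lemma norm_pointerState {C S : ℝ} (h : C ^ 2 + S ^ 2 = 1) (i : Fin 2) :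
    ‖pointerState C S i‖ = 1 := by
  rw [EuclideanSpace.norm_eq, Real.sqrt_eq_one]
  fin_cases i
  · simp [pointerState]
  · simp [pointerState, ← h, add_comm]

lemma isSelfAdjoint_pointerObservable (C S : ℝ) : IsSelfAdjoint (pointerObservable C S) := by
  rw [isSelfAdjoint_iff, pointerObservable, star_qubitOp]
  congr 1
  ext i j
  fin_cases i <;> fin_cases j <;> simp [Matrix.star_apply]

lemma pointerObservable_mul_self {C S : ℝ} (h : C ^ 2 + S ^ 2 = 1) :
    pointerObservable C S * pointerObservable C S = 1 := by
  have h' : (C : ℂ) ^ 2 + (S : ℂ) ^ 2 = 1 := by exact_mod_cast h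
  rw [pointerObservable, qubitOp_mul, ← qubitOp_one]
  congr 1
  ext i j
  fin_cases i <;> fin_cases j <;> simp [Matrix.mul_apply, Fin.sum_univ_two] <;>
    first | ring1 | linear_combination h'

lemma isStarProjection_diagonalProjection : IsStarProjection diagonalProjection := by
  constructor
  · rw [IsIdempotentElem, diagonalProjection, qubitOp_mul]
    congr 1
    ext i j
    fin_cases i <;> fin_cases j <;> simp [Matrix.mul_apply, Fin.sum_univ_two] <;> norm_num
  · rw [isSelfAdjoint_iff, diagonalProjection, star_qubitOp]
    congr 1
    ext i j
    fin_cases i <;> fin_cases j <;> simp [Matrix.star_apply]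

lemma inner_pointerObservable_zero (C S : ℝ) :
    inner ℂ (pointerState C S 0)
      ((pointerObservable C S : Qubit →L[ℂ] Qubit) (pointerState C S 0)) = C := by
  rw [pointerObservable, inner_qubitOp]
  simp [pointerState, Fin.sum_univ_two]

lemma inner_pointerObservable_one {C S : ℝ} (h : C ^ 2 + S ^ 2 = 1) :
    inner ℂ (pointerState C S 1)
      ((pointerObservable C S : Qubit →L[ℂ] Qubit) (pointerState C S 1)) = -C := by
  have h' : (C : ℂ) ^ 2 + (S : ℂ) ^ 2 = 1 := by exact_mod_cast h
  rw [pointerObservable, inner_qubitOp]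
  simp [pointerState, Fin.sum_univ_two]
  linear_combination (-(C : ℂ)) * h'

lemma inner_pointerState_zero_one (C S : ℝ) :
    inner ℂ (pointerState C S 0) (pointerState C S 1) = S := by
  simp [pointerState, PiLp.inner_apply, Fin.sum_univ_two]

lemma inner_pointerState_one_zero (C S : ℝ) :
    inner ℂ (pointerState C S 1) (pointerState C S 0) = S := by
  simp [pointerState, PiLp.inner_apply, Fin.sum_univ_two]

lemma inner_diagonalProjection (i j : Fin 2) :
    inner ℂ (EuclideanSpace.basisFun (Fin 2) ℂ i)
      ((diagonalProjection : Qubit →L[ℂ] Qubit) (EuclideanSpace.basisFun (Fin 2) ℂ j)) =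
      1 / 2 := by
  rw [diagonalProjection, inner_qubitOp]
  fin_cases i <;> fin_cases j <;> simp

/-- The qubit example in which the decoherence bound is attained. -/
theorem exists_traceDist_eq (s : ℝ) (hs : 0 ≤ s) :
    ∃ (T : CPMap (vnTensor (allOperators Qubit) (allOperators Qubit)) (allOperators Qubit))
      (B : allOperators Qubit) (x y : ℂ) (ψ φ : Qubit) (α β : ℂ),
      IsSelfAdjoint B ∧ x ≠ y ∧
      ‖ψ‖ = 1 ∧ (T (tmul 1 B) : Qubit →L[ℂ] Qubit) ψ = x • ψ ∧
      ‖φ‖ = 1 ∧ (T (tmul 1 B) : Qubit →L[ℂ] Qubit) φ = y • φ ∧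
      ‖α‖ ^ 2 + ‖β‖ ^ 2 = 1 ∧
      T.sigma (tmul 1 B) / ‖x - y‖ = s ∧
      traceDist (T.restr.dualMap (ketbra (allOperators Qubit) (α • ψ + β • φ)))
          (T.restr.dualMap (((‖α‖ ^ 2 : ℝ) : ℂ) • ketbra (allOperators Qubit) ψ +
            ((‖β‖ ^ 2 : ℝ) : ℂ) • ketbra (allOperators Qubit) φ)) =
        ENNReal.ofReal (s / √(1 + 4 * s ^ 2)) := by
  -- The eigenvalues will be `±C` and `Σ` will be `S`, so `S / (2C) = s` and `C² + S² = 1` force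
  -- these values.
  obtain ⟨C, hC⟩ : ∃ C : ℝ, C = 1 / √(1 + 4 * s ^ 2) := ⟨_, rfl⟩
  have hC0 : 0 < C := hC ▸ by positivity
  have hC2 : C ^ 2 * (1 + 4 * s ^ 2) = 1 := by
    rw [hC, div_pow, Real.sq_sqrt (by positivity)]
    field_simp
  obtain ⟨S, hS⟩ : ∃ S : ℝ, S = 2 * s * C := ⟨_, rfl⟩
  have hS0 : 0 ≤ S := hS ▸ by positivity
  have hCS : C ^ 2 + S ^ 2 = 1 := by rw [hS]; linear_combination hC2
  set e := EuclideanSpace.basisFun (Fin 2) ℂ with he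
  set T := pointerMap (allOperators Qubit) (allOperators Qubit) mem_allOperators e
    (pointerState C S) (norm_pointerState hCS) with hT
  have hB := isSelfAdjoint_pointerObservable C S
  have hxy : (C : ℂ) ≠ -C := by
    intro h
    have h' : C = -C := by exact_mod_cast h
    linarith
  have hx : (T (tmul 1 (pointerObservable C S)) : Qubit →L[ℂ] Qubit) (e 0) = (C : ℂ) • e 0 := by
    rw [hT, pointerMap_tmul_one_apply, inner_pointerObservable_zero]
  have hy : (T (tmul 1 (pointerObservable C S)) : Qubit →L[ℂ] Qubit) (e 1) =
      (-C : ℂ) • e 1 := by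
    rw [hT, pointerMap_tmul_one_apply, inner_pointerObservable_one hCS]
  have hσ : T.sigma (tmul 1 (pointerObservable C S)) = S := by
    rw [hT, sigma_pointerMap (r := C) (by rw [hB.star_eq, pointerObservable_mul_self hCS]) hB,
      ← hCS, add_sub_cancel_left, abs_of_nonneg (sq_nonneg S), Real.sqrt_sq hS0]
    intro i
    fin_cases i
    · exact congrArg (· ^ 2) (inner_pointerObservable_zero C S)
    · exact (congrArg (· ^ 2) (inner_pointerObservable_one hCS)).trans (neg_sq _)
  have hratio : T.sigma (tmul 1 (pointerObservable C S)) / ‖(C : ℂ) - -C‖ = s := by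
    have : ‖(C : ℂ) - -C‖ = 2 * C := by
      rw [sub_neg_eq_add, ← two_mul, norm_mul, Complex.norm_real, Real.norm_of_nonneg hC0.le]
      simp
    rw [hσ, this, hS]
    field_simp
  have hα : ‖((1 / √2 : ℝ) : ℂ)‖ ^ 2 = 1 / 2 := by
    rw [Complex.norm_real, Real.norm_eq_abs, sq_abs, div_pow, Real.sq_sqrt (by norm_num), one_pow]
  have hαβ : ‖((1 / √2 : ℝ) : ℂ)‖ ^ 2 + ‖((1 / √2 : ℝ) : ℂ)‖ ^ 2 = 1 := by rw [hα]; norm_num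
  have h0 : ‖e 0‖ = 1 := e.orthonormal.1 0
  have h1 : ‖e 1‖ = 1 := e.orthonormal.1 1
  refine ⟨T, pointerObservable C S, C, -C, e 0, e 1, ((1 / √2 : ℝ) : ℂ), ((1 / √2 : ℝ) : ℂ),
    hB, hxy, h0, hx, h1, hy, hαβ, hratio, le_antisymm ?_ ?_⟩
  · have := traceDist_restr_dualMap_le T hB hxy h0 hx h1 hy hαβ
    rwa [hratio] at this
  -- This projection has coherence `1/2` in the basis `e`, damped to `S / 2` by the pointer overlap;
  -- with `α = β = 1/√2` the cross terms add up to `S / 2`, which is the bound.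
  · refine le_iSup₂_of_le diagonalProjection isStarProjection_diagonalProjection ?_
    rw [LinearMap.dualMap_apply, LinearMap.dualMap_apply, ketbra_superposition_sub]
    change _ ≤ ‖_ * inner ℂ (e 0) ((T (tmul diagonalProjection 1) : Qubit →L[ℂ] Qubit) (e 1)) +
      _ * inner ℂ (e 1) ((T (tmul diagonalProjection 1) : Qubit →L[ℂ] Qubit) (e 0))‖ₑ
    rw [hT, inner_pointerMap, inner_pointerMap, he, inner_diagonalProjection,
      inner_diagonalProjection]
    change _ ≤ ‖_ * (_ * inner ℂ (pointerState C S 0) (pointerState C S 1)) +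
      _ * (_ * inner ℂ (pointerState C S 1) (pointerState C S 0))‖ₑ
    rw [inner_pointerState_zero_one, inner_pointerState_one_zero]
    have hval : star ((1 / √2 : ℝ) : ℂ) * ((1 / √2 : ℝ) : ℂ) = 1 / 2 := by
      have h := RCLike.conj_mul ((1 / √2 : ℝ) : ℂ)
      refine h.trans ?_
      have : ((‖((1 / √2 : ℝ) : ℂ)‖ ^ 2 : ℝ) : ℂ) = ((1 / 2 : ℝ) : ℂ) := by rw [hα]
      push_cast at this ⊢
      exact this
    rw [hval]
    have hfin : (1 / 2 : ℂ) * (1 / 2 * S) + 1 / 2 * (1 / 2 * S) =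
        ((s / √(1 + 4 * s ^ 2) : ℝ) : ℂ) := by
      have : s / √(1 + 4 * s ^ 2) = S / 2 := by rw [hS, hC]; ring
      rw [this]
      push_cast
      ring
    rw [hfin, ← ofReal_norm, Complex.norm_real, Real.norm_of_nonneg (by positivity)]

end Qubit

end QTransfer

end

theorem theorem6 :
    (∀ (H : Type u) [NormedAddCommGroup H] [InnerProductSpace ℂ H] [CompleteSpace H]
        (K : Type v) [NormedAddCommGroup K] [InnerProductSpace ℂ K] [CompleteSpace K]
        (𝒜 : VonNeumannAlgebra H) (ℬ : VonNeumannAlgebra K)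
        (T : CPMap (vnTensor 𝒜 ℬ) 𝒜) (B : ℬ) (x y : ℂ) (ψx ψy : H) (α β : ℂ),
      IsSelfAdjoint B → x ≠ y →
      ‖ψx‖ = 1 → (T (tmul 1 B) : H →L[ℂ] H) ψx = x • ψx →
      ‖ψy‖ = 1 → (T (tmul 1 B) : H →L[ℂ] H) ψy = y • ψy →
      ‖α‖ ^ 2 + ‖β‖ ^ 2 = 1 →
      traceDist (T.restr.dualMap (ketbra 𝒜 (α • ψx + β • ψy)))
          (T.restr.dualMap
            (((‖α‖ ^ 2 : ℝ) : ℂ) • ketbra 𝒜 ψx + ((‖β‖ ^ 2 : ℝ) : ℂ) • ketbra 𝒜 ψy)) ≤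
        ENNReal.ofReal
          ((T.sigma (tmul 1 B) / ‖x - y‖) / √(1 + 4 * (T.sigma (tmul 1 B) / ‖x - y‖) ^ 2))) ∧
    (∀ s : ℝ, 0 ≤ s →
      ∃ (H : Type) (_ : NormedAddCommGroup H) (_ : InnerProductSpace ℂ H) (_ : CompleteSpace H)
        (K : Type) (_ : NormedAddCommGroup K) (_ : InnerProductSpace ℂ K) (_ : CompleteSpace K)
        (𝒜 : VonNeumannAlgebra H) (ℬ : VonNeumannAlgebra K)
        (T : CPMap (vnTensor 𝒜 ℬ) 𝒜) (B : ℬ) (x y : ℂ) (ψx ψy : H) (α β : ℂ),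
      IsSelfAdjoint B ∧ x ≠ y ∧
      ‖ψx‖ = 1 ∧ (T (tmul 1 B) : H →L[ℂ] H) ψx = x • ψx ∧
      ‖ψy‖ = 1 ∧ (T (tmul 1 B) : H →L[ℂ] H) ψy = y • ψy ∧
      ‖α‖ ^ 2 + ‖β‖ ^ 2 = 1 ∧
      T.sigma (tmul 1 B) / ‖x - y‖ = s ∧
      traceDist (T.restr.dualMap (ketbra 𝒜 (α • ψx + β • ψy)))
          (T.restr.dualMap
            (((‖α‖ ^ 2 : ℝ) : ℂ) • ketbra 𝒜 ψx + ((‖β‖ ^ 2 : ℝ) : ℂ) • ketbra 𝒜 ψy)) =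
        ENNReal.ofReal (s / √(1 + 4 * s ^ 2))) := by
  refine ⟨fun H _ _ _ K _ _ _ 𝒜 ℬ T B x y ψx ψy α β hB hxy hψx hx hψy hy hαβ =>
    traceDist_restr_dualMap_le T hB hxy hψx hx hψy hy hαβ, fun s hs => ?_⟩
  obtain ⟨T, B, x, y, ψ, φ, α, β, h⟩ := exists_traceDist_eq s hs
  exact ⟨Qubit, inferInstance, inferInstance, inferInstance, Qubit, inferInstance, inferInstance,
    inferInstance, allOperators Qubit, allOperators Qubit, T, B, x, y, ψ, φ, α, β, h⟩
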